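/- Let $H$ be a complex Hilbert space and let $\mathcal U\subseteq B(H)$ be a norm-closed linear subspace containing the identity operator $I$. Let $C^*(\mathcal U)$ denote the $C^*$-subalgebra of $B(H)$ generated by $\mathcal U$, and let $C^*(\mathcal U)'=\{T\in B(H): TA=AT \text{ for all } A\in C^*(\mathcal U)\}$ be its commutant. Suppose that there is a set $\mathcal S$ of compact operators belonging to $C^*(\mathcal U)$ such that $KT\in\mathcal U$ for all $K\in\mathcal S$ and $T\in C^*(\mathcal U)'$, and such that $I$ belongs to the closure in the weak operator topology of the linear span of $\mathcal S+\mathcal S^*=\{K+L^*: K,L\in\mathcal S\}$. Then $\mathcal U$ has the trivial intersection property: every norm-closed two-sided ideal $J$ of $C^*(\mathcal U)$ with $\mathcal U\cap J=\{0\}$ is $\{0\}$. -/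

import Mathlib

open scoped Pointwise

/-- `C*(U)`: the norm-closed unital `*`-subalgebra of `B(H)` generated by `U`.
(For `U` containing the identity operator this is the `C*`-algebra generated by `U`.) -/
noncomputable def cstarGenerated {H : Type*} [NormedAddCommGroup H] [InnerProductSpace ℂ H]
    [CompleteSpace H] (U : Submodule ℂ (H →L[ℂ] H)) : StarSubalgebra ℂ (H →L[ℂ] H) :=
  (StarAlgebra.adjoin ℂ (U : Set (H →L[ℂ] H))).topologicalClosure

/-- The trivial intersection property of a concrete unital operator space `U ⊆ B(H)`:
every norm-closed two-sided ideal `J` of `C*(U)` with `U ∩ J = {0}` is zero. -/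
def HasTrivialIntersectionProperty {H : Type*} [NormedAddCommGroup H] [InnerProductSpace ℂ H]
    [CompleteSpace H] (U : Submodule ℂ (H →L[ℂ] H)) : Prop :=
  ∀ J : Ideal (cstarGenerated U), J.IsTwoSided → IsClosed (J : Set (cstarGenerated U)) →
    (U : Set (H →L[ℂ] H)) ∩ ((fun x : cstarGenerated U => (x : H →L[ℂ] H)) '' J) = {0} →
    J = ⊥

/-- The closure in the weak operator topology of a set of bounded operators. -/
def wotClosure {H : Type*} [NormedAddCommGroup H] [InnerProductSpace ℂ H]
    (V : Set (H →L[ℂ] H)) : Set (H →L[ℂ] H) :=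
  {T | ContinuousLinearMapWOT.ofCLM T ∈
    closure ((fun A : H →L[ℂ] H => (ContinuousLinearMapWOT.ofCLM A : H →WOT[ℂ] H)) '' V)}

/-!
Let `e` be the projection onto the closed span of the ranges of the operators in `J`; it commutes
with `C*(U)`, and `J = 0` as soon as `e = 0`. A norm-bounded left approximate unit of `J` converges
strongly to the identity on the range of `e`, hence in norm after multiplication by a compact
operator, so `e K ∈ J` for every compact `K ∈ C*(U)`. For `K ∈ S` this gives `K e = e K ∈ U ∩ J`,
so `K e = 0` and, taking adjoints in `e K = 0`, also `K* e = 0`. Linear combinations and weak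
operator limits preserve the relation `T e = 0`, and `T = 1` gives `e = 0`.
-/

open Filter Topology

section EquicontinuousConvergence

variable {𝕜 E F G ι : Type*} [NontriviallyNormedField 𝕜]
  [AddCommGroup E] [Module 𝕜 E] [TopologicalSpace E]
  [AddCommGroup F] [Module 𝕜 F] [TopologicalSpace F] [T2Space F] [ContinuousConstSMul 𝕜 F]
  [AddCommGroup G] [Module 𝕜 G] [UniformSpace G] [IsUniformAddGroup G]

-- On the relatively compact image of a bounded set, pointwise convergence of an equicontinuous
-- family is uniform (Ascoli).
theorem tendsto_comp_of_isCompactOperator {l : Filter ι} {T : ι → F →L[𝕜] G} {T₀ : F →L[𝕜] G}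
    (hT : Equicontinuous fun i => (T i : F → G)) {K : E →L[𝕜] F} (hK : IsCompactOperator K)
    (hTK : ∀ x, Tendsto (fun i => T i (K x)) l (𝓝 (T₀ (K x)))) :
    Tendsto (fun i => T i ∘L K) l (𝓝 (T₀ ∘L K)) := by
  rw [ContinuousLinearMap.isUniformEmbedding_toUniformOnFun.isEmbedding.tendsto_nhds_iff,
    UniformOnFun.tendsto_iff_tendstoUniformlyOn]
  intro s hs
  have hcompact : IsCompact (closure (K '' s)) :=
    IsCompactOperator.isCompact_closure_image_of_isVonNBounded (f := (K : E →ₗ[𝕜] F)) hK hs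
  have hpointwise : closure (K '' s) ⊆ {y | Tendsto (fun i => T i y) l (𝓝 (T₀ y))} :=
    closure_minimal (Set.image_subset_iff.2 fun x _ => hTK x)
      (hT.isClosed_setOfPred_tendsto T₀.continuous)
  have huniform : TendstoUniformlyOn (fun i => (T i : F → G)) T₀ l (closure (K '' s)) :=
    UniformOnFun.tendsto_iff_tendstoUniformlyOn.1
      ((EquicontinuousOn.tendsto_uniformOnFun_iff_pi' (𝔖 := {closure (K '' s)})
        (by simpa only [Set.mem_singleton_iff, forall_eq] using hcompact)
        (fun _ _ => hT.equicontinuousOn _) l T₀).2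
        (tendsto_pi_nhds.2 fun y => hpointwise (by simpa using y.2))) _ rfl
  exact (huniform.comp K).mono fun x hx => subset_closure (Set.mem_image_of_mem K hx)

end EquicontinuousConvergence

section ApproximateUnit

variable {A : Type*}

/-- The subalgebra `J ∩ J*` of a left ideal `J` of a star algebra. When `J` is closed in a
C⋆-algebra this is a possibly non-unital C⋆-algebra, the hereditary subalgebra attached to `J`;
working in it avoids having to know that closed two-sided ideals are self-adjoint. -/
def hereditarySubalgebra (R : Type*) [CommSemiring R] [StarRing R] [Semiring A] [StarRing A]
    [Algebra R A] [StarModule R A] (J : Ideal A) : NonUnitalStarSubalgebra R A where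
  carrier := {a | a ∈ J ∧ star a ∈ J}
  add_mem' ha hb := ⟨J.add_mem ha.1 hb.1, by rw [star_add]; exact J.add_mem ha.2 hb.2⟩
  zero_mem' := ⟨J.zero_mem, by rw [star_zero]; exact J.zero_mem⟩
  mul_mem' {a b} ha hb := ⟨J.mul_mem_left a hb.1, by rw [star_mul]; exact J.mul_mem_left _ ha.2⟩
  smul_mem' c a ha :=
    ⟨J.smul_of_tower_mem c ha.1, by rw [star_smul]; exact J.smul_of_tower_mem _ ha.2⟩
  star_mem' ha := ⟨ha.2, by rw [star_star]; exact ha.1⟩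

theorem norm_mul_sub_self_sq_le [NonUnitalNormedRing A] [StarRing A] [CStarRing A] {u : A}
    (hu : ‖u‖ ≤ 1) (a : A) :
    ‖u * a - a‖ ^ 2 ≤ 2 * ‖u * (a * star a) - a * star a‖ := by
  set d := u * (a * star a) - a * star a with hd
  have hfactor : (u * a - a) * star (u * a - a) = d * star u - d := by
    simp only [hd, star_sub, star_mul]
    noncomm_ring
  calc ‖u * a - a‖ ^ 2 = ‖d * star u - d‖ := by
        rw [← hfactor, CStarRing.norm_self_mul_star, sq]
    _ ≤ ‖d‖ * ‖star u‖ + ‖d‖ := (norm_sub_le _ _).trans (by gcongr; exact norm_mul_le _ _)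
    _ ≤ ‖d‖ * 1 + ‖d‖ := by gcongr; rwa [norm_star]
    _ = 2 * ‖d‖ := by ring

theorem exists_leftApproximateUnit_of_isTwoSided [CStarAlgebra A] (J : Ideal A) [J.IsTwoSided]
    (hJ : IsClosed (J : Set A)) :
    ∃ l : Filter {u : A // u ∈ J ∧ ‖u‖ ≤ 1}, l.NeBot ∧
      ∀ a ∈ J, Tendsto (fun u : {u : A // u ∈ J ∧ ‖u‖ ≤ 1} => (u : A) * a) l (𝓝 a) := by
  let N : NonUnitalStarSubalgebra ℂ A := hereditarySubalgebra ℂ J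
  have : IsClosed (N : Set A) := hJ.inter (hJ.preimage continuous_star)
  let _ := CStarAlgebra.spectralOrder N
  let _ := CStarAlgebra.spectralOrderedRing N
  have hN := CStarAlgebra.increasingApproximateUnit N
  set l : Filter A := map (↑) (CStarAlgebra.approximateUnit N)
  have hl : l ≤ 𝓟 {u | u ∈ J ∧ ‖u‖ ≤ 1} :=
    le_principal_iff.2 (hN.eventually_norm.mono fun u hu => ⟨u.2.1, hu⟩)
  refine ⟨comap (↑) l, comap_coe_neBot_of_le_principal hl, fun a ha => ?_⟩
  have haa : a * star a ∈ N :=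
    ⟨J.mul_mem_right _ ha, by simpa only [star_mul, star_star] using J.mul_mem_right _ ha⟩
  have hmul : Tendsto (fun u => u * (a * star a)) l (𝓝 (a * star a)) :=
    tendsto_map'_iff.2 <|
      (continuous_subtype_val.tendsto _).comp (hN.tendsto_mul_right ⟨a * star a, haa⟩)
  have hsq : Tendsto (fun u : {u : A // u ∈ J ∧ ‖u‖ ≤ 1} => ‖(u : A) * a - a‖ ^ 2)
      (comap (↑) l) (𝓝 0) := by
    refine squeeze_zero (fun _ => sq_nonneg _) (fun u => norm_mul_sub_self_sq_le u.2.2 a) ?_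
    simpa only [mul_zero, Function.comp_def] using
      ((tendsto_iff_norm_sub_tendsto_zero.1 hmul).const_mul 2).comp tendsto_comap
  exact tendsto_iff_norm_sub_tendsto_zero.2 (by simpa using hsq.sqrt)

end ApproximateUnit

section EssentialSubspace

variable {𝕜 E F ι : Type*} [NontriviallyNormedField 𝕜] [NormedAddCommGroup E] [NormedSpace 𝕜 E]
  [NormedAddCommGroup F] [NormedSpace 𝕜 F] {𝒥 : Set (E →L[𝕜] F)}

/-- The closed subspace spanned by the ranges of the operators in `𝒥`. For a two-sided ideal of an
operator algebra it is the subspace on which the ideal acts nondegenerately. -/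
def essentialSubspace (𝒥 : Set (E →L[𝕜] F)) : Submodule 𝕜 F :=
  (Submodule.span 𝕜 (⋃ T ∈ 𝒥, Set.range T)).topologicalClosure

theorem isClosed_essentialSubspace : IsClosed (essentialSubspace 𝒥 : Set F) :=
  Submodule.isClosed_topologicalClosure _

theorem apply_mem_essentialSubspace {T : E →L[𝕜] F} (hT : T ∈ 𝒥) (x : E) :
    T x ∈ essentialSubspace 𝒥 :=
  Submodule.le_topologicalClosure _ <|
    Submodule.subset_span (Set.mem_biUnion hT (Set.mem_range_self x))

theorem essentialSubspace_le {M : Submodule 𝕜 F} (hM : IsClosed (M : Set F))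
    (h : ∀ T ∈ 𝒥, ∀ x, T x ∈ M) : essentialSubspace 𝒥 ≤ M :=
  Submodule.topologicalClosure_minimal _
    (Submodule.span_le.2 (Set.iUnion₂_subset fun T hT => Set.range_subset_iff.2 (h T hT))) hM

theorem essentialSubspace_mem_invtSubmodule {S : F →L[𝕜] F} (hS : ∀ T ∈ 𝒥, S ∘L T ∈ 𝒥) :
    essentialSubspace 𝒥 ∈ Module.End.invtSubmodule (S : F →ₗ[𝕜] F) :=
  essentialSubspace_le (isClosed_essentialSubspace.preimage S.continuous) fun T hT x =>
    apply_mem_essentialSubspace (hS T hT) x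

theorem tendsto_apply_of_mem_essentialSubspace {l : Filter ι} {u : ι → F →L[𝕜] F}
    (hu : Equicontinuous fun i => (u i : F → F))
    (huT : ∀ T ∈ 𝒥, Tendsto (fun i => u i ∘L T) l (𝓝 T)) {y : F}
    (hy : y ∈ essentialSubspace 𝒥) : Tendsto (fun i => u i y) l (𝓝 y) := by
  let M : Submodule 𝕜 F :=
    { carrier := {y | Tendsto (fun i => u i y) l (𝓝 y)}
      add_mem' := fun hy hz => by simpa only [Set.mem_ofPred_eq, map_add] using hy.add hz
      zero_mem' := by simpa only [Set.mem_ofPred_eq, map_zero] using tendsto_const_nhds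
      smul_mem' := fun c y hy => by simpa only [Set.mem_ofPred_eq, map_smul] using hy.const_smul c }
  have hM : IsClosed (M : Set F) := hu.isClosed_setOfPred_tendsto continuous_id
  have hTM : ∀ T ∈ 𝒥, ∀ x, T x ∈ M := fun T hT x =>
    ((continuous_eval_const x).tendsto T).comp (huT T hT)
  exact essentialSubspace_le hM hTM hy

end EssentialSubspace

section HilbertSpace

variable {𝕜 E : Type*} [RCLike 𝕜] [NormedAddCommGroup E] [InnerProductSpace 𝕜 E] [CompleteSpace E]

instance completeSpace_essentialSubspace (𝒥 : Set (E →L[𝕜] E)) :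
    CompleteSpace (essentialSubspace 𝒥) :=
  isClosed_essentialSubspace.completeSpace_coe

theorem starProjection_essentialSubspace_mul {𝒥 : Set (E →L[𝕜] E)} {T : E →L[𝕜] E} (hT : T ∈ 𝒥) :
    (essentialSubspace 𝒥).starProjection * T = T :=
  ContinuousLinearMap.ext fun x =>
    Submodule.starProjection_eq_self_iff.2 (apply_mem_essentialSubspace hT x)

theorem commute_starProjection_of_mem_invtSubmodule {M : Submodule 𝕜 E}
    [M.HasOrthogonalProjection] {T : E →L[𝕜] E}
    (hT : M ∈ Module.End.invtSubmodule (T : E →ₗ[𝕜] E))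
    (hT_star : M ∈ Module.End.invtSubmodule (star T : E →L[𝕜] E).toLinearMap) :
    Commute M.starProjection T := by
  rw [ContinuousLinearMap.IsIdempotentElem.commute_iff M.isIdempotentElem_starProjection,
    M.range_starProjection, M.ker_starProjection]
  exact ⟨hT, ContinuousLinearMap.orthogonal_mem_invtSubmodule hT_star⟩

theorem starProjection_essentialSubspace_mem_centralizer {A : StarSubalgebra 𝕜 (E →L[𝕜] E)}
    (J : Ideal A) :
    (essentialSubspace ((↑) '' (J : Set A) : Set (E →L[𝕜] E))).starProjection ∈
      Set.centralizer (A : Set (E →L[𝕜] E)) := by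
  have hinvt : ∀ a ∈ A, essentialSubspace ((↑) '' (J : Set A) : Set (E →L[𝕜] E)) ∈
      Module.End.invtSubmodule (a : E →ₗ[𝕜] E) := fun a ha =>
    essentialSubspace_mem_invtSubmodule <| by
      rintro _ ⟨j, hj, rfl⟩
      exact ⟨⟨a, ha⟩ * j, J.mul_mem_left _ hj, rfl⟩
  exact fun a ha =>
    (commute_starProjection_of_mem_invtSubmodule (hinvt a ha) (hinvt _ (star_mem ha))).symm

end HilbertSpace

section Annihilation

variable {H : Type*} [NormedAddCommGroup H] [InnerProductSpace ℂ H]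

theorem mul_eq_zero_of_mem_wotClosure {V : Set (H →L[ℂ] H)} {e T : H →L[ℂ] H}
    (hV : ∀ A ∈ V, A * e = 0) (hT : T ∈ wotClosure V) : T * e = 0 := by
  have hclosed : IsClosed {A : H →WOT[ℂ] H | A * .ofCLM e = 0} :=
    isClosed_singleton.preimage (continuous_mul_const _)
  have hsubset : (fun A : H →L[ℂ] H => (ContinuousLinearMapWOT.ofCLM A : H →WOT[ℂ] H)) '' V ⊆
      {A | A * .ofCLM e = 0} :=
    Set.image_subset_iff.2 fun A hA => congrArg ContinuousLinearMapWOT.ofCLM (hV A hA)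
  exact congrArg ContinuousLinearMapWOT.toCLM (closure_minimal hsubset hclosed hT)

theorem mul_eq_zero_of_mem_span_add_star {R B : Type*} [CommSemiring R] [Semiring B] [StarRing B]
    [Algebra R B] {S : Set B} {e T : B} (he : IsSelfAdjoint e) (hSe : ∀ K ∈ S, K * e = 0)
    (heS : ∀ K ∈ S, e * K = 0) (hT : T ∈ Submodule.span R (S + star S)) : T * e = 0 := by
  suffices Submodule.span R (S + star S) ≤ LinearMap.ker (LinearMap.mulRight R e) from this hT
  refine Submodule.span_le.2 ?_
  rintro _ ⟨K, hK, L, hL, rfl⟩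
  have hLe : L * e = 0 := by simpa [he.star_eq] using congrArg star (heS _ hL)
  simp [add_mul, hSe K hK, hLe]

end Annihilation

section CompactOperators

variable {H : Type*} [NormedAddCommGroup H] [InnerProductSpace ℂ H] [CompleteSpace H]

theorem starProjection_essentialSubspace_mul_mem {A : StarSubalgebra ℂ (H →L[ℂ] H)}
    (hA : IsClosed (A : Set (H →L[ℂ] H))) {J : Ideal A} [J.IsTwoSided]
    (hJ : IsClosed (J : Set A)) {K : H →L[ℂ] H} (hKA : K ∈ A) (hK : IsCompactOperator K) :
    (essentialSubspace ((↑) '' (J : Set A) : Set (H →L[ℂ] H))).starProjection * K ∈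
      ((↑) '' (J : Set A) : Set (H →L[ℂ] H)) := by
  set M := essentialSubspace ((↑) '' (J : Set A) : Set (H →L[ℂ] H))
  set e := M.starProjection
  obtain ⟨l, _, hl⟩ := exists_leftApproximateUnit_of_isTwoSided J hJ
  let u (i : {u : A // u ∈ J ∧ ‖u‖ ≤ 1}) : H →L[ℂ] H := (i : A)
  have hu_bounded : ∃ C, ∀ i, ‖u i‖ ≤ C := ⟨1, fun i => i.2.2⟩
  have hu_equicontinuous : Equicontinuous fun i => (u i : H → H) :=
    ((NormedSpace.equicontinuous_TFAE u).out 5 1).1 hu_bounded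
  have hu_strong : ∀ y ∈ M, Tendsto (fun i => u i y) l (𝓝 y) := fun y hy =>
    tendsto_apply_of_mem_essentialSubspace hu_equicontinuous
      (by rintro _ ⟨j, hj, rfl⟩; exact (continuous_subtype_val.tendsto j).comp (hl j hj)) hy
  have huJ (i) : u i ∈ ((↑) '' (J : Set A) : Set (H →L[ℂ] H)) := ⟨i, i.2.1, rfl⟩
  have hue (i) : u i * e = u i :=
    (starProjection_essentialSubspace_mem_centralizer J _ i.1.2).trans
      (starProjection_essentialSubspace_mul (huJ i))
  have hlim : Tendsto (fun i => u i * K) l (𝓝 (e * K)) := by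
    have h : Tendsto (fun i => u i * (e * K)) l (𝓝 (1 * (e * K))) :=
      tendsto_comp_of_isCompactOperator hu_equicontinuous (hK.clm_comp e) fun x =>
        hu_strong _ (M.starProjection_apply_mem _)
    simpa only [← mul_assoc, hue, one_mul] using h
  exact (hA.isClosedEmbedding_subtypeVal.isClosedMap _ hJ).mem_of_tendsto hlim <|
    .of_forall fun i => ⟨i * ⟨K, hKA⟩, J.mul_mem_right _ i.2.1, rfl⟩

end CompactOperators

theorem theorem3_general {H : Type*} [NormedAddCommGroup H] [InnerProductSpace ℂ H]
    [CompleteSpace H] {A : StarSubalgebra ℂ (H →L[ℂ] H)} (hA : IsClosed (A : Set (H →L[ℂ] H)))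
    {U S : Set (H →L[ℂ] H)}
    (hSA : S ⊆ {K : H →L[ℂ] H | IsCompactOperator K} ∩ (A : Set (H →L[ℂ] H)))
    (hSU : S * Set.centralizer (A : Set (H →L[ℂ] H)) ⊆ U)
    (hS : (1 : H →L[ℂ] H) ∈ wotClosure (Submodule.span ℂ (S + star S) : Set (H →L[ℂ] H)))
    {J : Ideal A} [J.IsTwoSided] (hJ : IsClosed (J : Set A))
    (hUJ : U ∩ ((↑) '' (J : Set A)) ⊆ {0}) : J = ⊥ := by
  set e := (essentialSubspace ((↑) '' (J : Set A) : Set (H →L[ℂ] H))).starProjection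
  have he : e ∈ Set.centralizer (A : Set (H →L[ℂ] H)) :=
    starProjection_essentialSubspace_mem_centralizer J
  have heS : ∀ K ∈ S, e * K = 0 := fun K hK => hUJ
    ⟨he K (hSA hK).2 ▸ hSU (Set.mul_mem_mul hK he),
      starProjection_essentialSubspace_mul_mem hA hJ (hSA hK).2 (hSA hK).1⟩
  have hSe : ∀ K ∈ S, K * e = 0 := fun K hK => (he K (hSA hK).2).trans (heS K hK)
  have he_zero : 1 * e = 0 := mul_eq_zero_of_mem_wotClosure
    (fun _ => mul_eq_zero_of_mem_span_add_star (isSelfAdjoint_starProjection _) hSe heS) hS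
  refine (Submodule.eq_bot_iff J).2 fun j hj => Subtype.ext ?_
  calc (j : H →L[ℂ] H) = e * j :=
        (starProjection_essentialSubspace_mul (Set.mem_image_of_mem _ hj)).symm
    _ = 0 := by rw [← one_mul e, he_zero, zero_mul]

theorem theorem3 {H : Type*} [NormedAddCommGroup H] [InnerProductSpace ℂ H] [CompleteSpace H]
    (U : Submodule ℂ (H →L[ℂ] H)) (hU_closed : IsClosed (U : Set (H →L[ℂ] H)))
    (hU_unital : (1 : H →L[ℂ] H) ∈ U)
    (hS : ∃ S : Set (H →L[ℂ] H),
      S ⊆ {K : H →L[ℂ] H | IsCompactOperator K} ∩ (cstarGenerated U : Set (H →L[ℂ] H)) ∧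
      S * Set.centralizer (cstarGenerated U : Set (H →L[ℂ] H)) ⊆ (U : Set (H →L[ℂ] H)) ∧
      (1 : H →L[ℂ] H) ∈ wotClosure (Submodule.span ℂ (S + star S) : Set (H →L[ℂ] H))) :
    HasTrivialIntersectionProperty U := by
  obtain ⟨S, hSA, hSU, hS⟩ := hS
  have hA := StarSubalgebra.isClosed_topologicalClosure (StarAlgebra.adjoin ℂ (U : Set (H →L[ℂ] H)))
  exact fun J _ hJ hUJ => theorem3_general (A := cstarGenerated U) hA hSA hSU hS hJ hUJ.subset
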